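/- A weighted digraph $G^W$ is a finite digraph $G=(V,E)$ with a function $W:E\to\mathbb R$ (weights may be zero or negative). If $G$ is strongly connected, its distance matrix is $D=D(G^W)=[d_{xy}]_{x,y\in V}$, where $d_{xx}=0$ and $d_{xy}$ is the minimum total weight of a directed path (without repeated vertices) from $x$ to $y$. For a square matrix $A$, $\operatorname{cof}A$ denotes the sum of all cofactors $(-1)^{i+j}\det A(i\mid j)$ of $A$, where $A(i\mid j)$ is $A$ with row $i$ and column $j$ deleted. A block of $G$ is a maximal connected subgraph without cut-vertex, where connectedness and cut-vertices refer to the underlying undirected graph. For $n,r\ge 1$ and $m_1,\dots,m_r\ge 1$, let $dC(n;m_1,\dots,m_r)$ be the digraph that consists of a directed path $u_0\to u_1\to\cdots\to u_n$ and, for each $1\le j\le r$, a directed path $u_n\to v^{(j)}_1\to\cdots\to v^{(j)}_{m_j}\to u_0$, all the vertices $u_i$, $v^{(j)}_k$ being distinct. A (nonempty) strongly connected digraph is called cactoid-type if each of its blocks is isomorphic to some $dC(n;m_1,\dots,m_r)$ with $n,r\ge1$ and all $m_j\ge1$. **Theorem.** Let $G=(V,E)$ be a cactoid-type digraph with blocks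 $G_1,\dots,G_b$, and let $W:E\to\mathbb R$ be a weight function. Let $D$ be the distance matrix of $G^W$ and, for $1\le t\le b$, let $D_t$ be the distance matrix of the block $G_t$ with the restricted weights. If $\operatorname{cof}D_t\ne0$ for all $1\le t\le b$, then $$\det D=\lambda\prod_{t=1}^{b}\operatorname{cof}D_t=\lambda\operatorname{cof}D,\qquad\text{where}\quad \lambda=\sum_{t=1}^{b}\lambda_t,\quad \lambda_t=\frac{\det D_t}{\operatorname{cof}D_t}.$$ -/

import Mathlib

namespace Cactoid

/-! ### Directed paths and distance matrices of weighted digraphs -/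

/-- `l` is the vertex sequence of a directed path of `G` from `x` to `y`: consecutive vertices
are joined by directed edges and no vertex is repeated. The one-term sequence is the path of
length zero. -/
structure IsDirPath {V : Type*} (G : Digraph V) (l : List V) (x y : V) : Prop where
  head_eq : l.head? = some x
  last_eq : l.getLast? = some y
  chain : l.IsChain G.Adj
  nodup : l.Nodup

/-- The total weight of a path: the sum of the weights `W u v` of the edges `u → v` between
consecutive vertices. -/
def pathWeight {V : Type*} (W : V → V → ℝ) : List V → ℝ
  | [] => 0
  | [_] => 0
  | u :: v :: l => W u v + pathWeight W (v :: l)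

/-- A digraph is strongly connected if it is nonempty and there is a directed path from every
vertex to every vertex. -/
def StronglyConnected {V : Type*} (G : Digraph V) : Prop :=
  Nonempty V ∧ ∀ x y : V, ∃ l : List V, IsDirPath G l x y

/-- The distance matrix of the weighted digraph `(G, W)`: its `(x, y)` entry is the minimum total
weight of a directed path from `x` to `y`. (A finite digraph has finitely many directed paths, so
the infimum is a minimum as soon as there is a path; the only path from `x` to `x` has length zero,
so diagonal entries vanish.) The weight function is only ever evaluated on edges of `G`. -/
noncomputable def distMatrix {V : Type*} (G : Digraph V) (W : V → V → ℝ) : Matrix V V ℝ :=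
  Matrix.of fun x y => sInf {w : ℝ | ∃ l : List V, IsDirPath G l x y ∧ pathWeight W l = w}

/-- The sum of all cofactors of a square matrix; the `(i, j)` cofactor is the `(j, i)` entry of
the adjugate. -/
def cof {ι : Type*} [Fintype ι] [DecidableEq ι] (A : Matrix ι ι ℝ) : ℝ :=
  ∑ i, ∑ j, A.adjugate j i

/-! ### Blocks -/

/-- The subgraph of `G` induced on a finite set `B` of vertices. -/
def induced {V : Type*} (G : Digraph V) (B : Finset V) : Digraph B where
  Adj u v := G.Adj u v

/-- The restriction of a weight function to a finite set `B` of vertices. -/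
def restrictWeight {V : Type*} (W : V → V → ℝ) (B : Finset V) : B → B → ℝ :=
  fun u v => W u v

/-- The subgraph of `G` induced on `B` is connected (forgetting orientations) and has no
cut-vertex, a cut-vertex being a vertex whose deletion leaves a disconnected graph. -/
def ConnectedNoCutVertex {V : Type*} (G : Digraph V) (B : Finset V) : Prop :=
  (G.toSimpleGraphInclusive.induce (B : Set V)).Connected ∧
    ∀ v ∈ B, (G.toSimpleGraphInclusive.induce ((B : Set V) \ {v})).Preconnected

/-- `B` is the vertex set of a block of `G`, that is, of a maximal connected subgraph without
cut-vertex. (Adding edges creates no cut-vertex, so such a maximal subgraph is the induced subgraph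
on its vertex set.) -/
def IsBlock {V : Type*} (G : Digraph V) (B : Finset V) : Prop :=
  Maximal (ConnectedNoCutVertex G) B

open scoped Classical in
/-- The finite set of the (vertex sets of the) blocks of `G`. -/
noncomputable def blocks {V : Type*} [Fintype V] (G : Digraph V) : Finset (Finset V) :=
  Finset.univ.filter (IsBlock G)

/-! ### Cactoid-type digraphs -/

/-- The digraph `dC(n; m₁, …, m_r)`: a common directed path `u₀ → u₁ → ⋯ → u_n` together with, for
each `j`, a directed path `u_n → v₁⁽ʲ⁾ → ⋯ → v_{m_j}⁽ʲ⁾ → u₀` through `m_j` new vertices. The vertex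
`u_i` is `Sum.inl i`, and `v_{k+1}⁽ʲ⁾` is `Sum.inr ⟨j, k⟩`. Meaningful when every `m_j` is positive. -/
def dC (n : ℕ) {r : ℕ} (m : Fin r → ℕ) : Digraph (Fin (n + 1) ⊕ (Σ j : Fin r, Fin (m j))) where
  Adj
    | .inl i, .inl i' => (i' : ℕ) = i + 1
    | .inl i, .inr v => (i : ℕ) = n ∧ (v.2 : ℕ) = 0
    | .inr v, .inl i => (v.2 : ℕ) + 1 = m v.1 ∧ (i : ℕ) = 0
    | .inr v, .inr v' => v.1 = v'.1 ∧ (v'.2 : ℕ) = v.2 + 1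

/-- A strongly connected digraph is cactoid-type if each of its blocks is (isomorphic to) a digraph
`dC(n; m₁, …, m_r)` with `n, r ≥ 1` and all `m_j ≥ 1`. -/
def IsCactoidType {V : Type*} (G : Digraph V) : Prop :=
  StronglyConnected G ∧
    ∀ B : Finset V, IsBlock G B →
      ∃ (n r : ℕ) (m : Fin r → ℕ), 1 ≤ n ∧ 1 ≤ r ∧ (∀ j, 1 ≤ m j) ∧
        Nonempty ((induced G B).Adj ≃r (dC n m).Adj)

/-- The distance matrix `D_t` of the weighted block with vertex set `B`; distances are measured
inside the block. -/
noncomputable def blockMatrix {V : Type*} (G : Digraph V) (W : V → V → ℝ) (B : Finset V) :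
    Matrix B B ℝ :=
  distMatrix (induced G B) (restrictWeight W B)

/-- `λ = ∑_t det D_t / cof D_t`, the sum running over the blocks of `G`. -/
noncomputable def lam {V : Type*} [Fintype V] [DecidableEq V] (G : Digraph V) (W : V → V → ℝ) : ℝ :=
  ∑ B ∈ blocks G, (blockMatrix G W B).det / cof (blockMatrix G W B)

end Cactoid

/-!
A cut-vertex `c` of a strongly connected digraph splits its vertex set into two parts `S₁` and `S₂`
sharing only `c`. Every path from one part to the other passes through `c`, so
`d(x, y) = d(x, c) + d(c, y)` across the parts. Subtracting row and column `c` of the distance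
matrix from the others therefore leaves zeros between `S₁ \ {c}` and `S₂ \ {c}`. The sum of the
cofactors is the determinant of the reduced matrix off `c`, which is now block diagonal, so it is
multiplicative; splitting row `c` into its parts in `S₁` and in `S₂` gives
`det D = det D₁ cof D₂ + det D₂ cof D₁`. Induction over cut-vertices reaches the blocks.
-/

namespace Cactoid

open Matrix

/-! ### Determinants and cofactor sums of principal submatrices -/

section PrincipalSubmatrix

variable {ι R : Type*} {S T : Finset ι} {c : ι}

/-- The principal submatrix of `A` with index set `S`. -/
def principal (A : Matrix ι ι R) (S : Finset ι) : Matrix S S R :=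
  A.submatrix (↑) (↑)

theorem principal_congr {A B : Matrix ι ι R} (h : ∀ i ∈ S, ∀ j ∈ S, A i j = B i j) :
    principal A S = principal B S := by
  ext i j
  exact h i i.2 j j.2

variable [DecidableEq ι]

theorem principal_updateRow (A : Matrix ι ι R) (hc : c ∈ S) (v : ι → R) :
    principal (A.updateRow c v) S = (principal A S).updateRow ⟨c, hc⟩ fun j => v j := by
  ext i j
  simp only [principal, submatrix_apply, updateRow_apply, Subtype.ext_iff]

variable [CommRing R]

theorem det_principal_union_of_disjoint {A : Matrix ι ι R} (hST : Disjoint S T)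
    (hA : ∀ i ∈ S, ∀ j ∈ T, A i j = 0) :
    (principal A (S ∪ T)).det = (principal A S).det * (principal A T).det := by
  rw [← det_fromBlocks_zero₁₂ _ (of fun (i : T) (j : S) => A i j),
    ← det_submatrix_equiv_self (Equiv.Finset.union S T hST)]
  congr 1
  ext (i | i) (j | j)
  · rfl
  · exact hA i i.2 j j.2
  · rfl
  · rfl

theorem det_principal_updateRow_indicator {A : Matrix ι ι R} (hST : S ∩ T = {c})
    (hA : ∀ i ∈ S, i ≠ c → ∀ j ∈ T, j ≠ c → A i j = 0) :
    (principal (A.updateRow c ((S : Set ι).indicator (A c))) (S ∪ T)).det =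
      (principal A S).det * (principal A (T.erase c)).det := by
  have hc : c ∈ S ∩ T := hST ▸ Finset.mem_singleton_self c
  have hdisj : Disjoint S (T.erase c) := by
    rw [Finset.disjoint_iff_inter_eq_empty, Finset.inter_erase, hST, Finset.erase_singleton]
  rw [← Finset.union_erase_of_mem (Finset.mem_inter.1 hc).1, det_principal_union_of_disjoint hdisj]
  · congr 2 <;> refine principal_congr fun i hi j hj => ?_
    · rcases eq_or_ne i c with rfl | hic
      · simp [hj]
      · simp [hic]
    · simp [Finset.ne_of_mem_erase hi]
  · intro i hi j hj
    rcases eq_or_ne i c with rfl | hic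
    · simp [Finset.disjoint_right.1 hdisj hj]
    · simp [hic, hA i hi hic j (Finset.mem_of_mem_erase hj) (Finset.ne_of_mem_erase hj)]

theorem det_principal_union_of_inter_eq_singleton {A : Matrix ι ι R} (hST : S ∩ T = {c})
    (hcc : A c c = 0) (hA : ∀ i ∈ S, i ≠ c → ∀ j ∈ T, j ≠ c → A i j = 0 ∧ A j i = 0) :
    (principal A (S ∪ T)).det = (principal A S).det * (principal A (T.erase c)).det +
      (principal A T).det * (principal A (S.erase c)).det := by
  have hc : c ∈ S ∪ T := Finset.inter_subset_union (hST ▸ Finset.mem_singleton_self c)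
  have hrow : ∀ j ∈ S ∪ T,
      A c j = (S : Set ι).indicator (A c) j + (T : Set ι).indicator (A c) j := by
    intro j hj
    by_cases hjS : j ∈ S <;> by_cases hjT : j ∈ T
    · obtain rfl : j = c := Finset.mem_singleton.1 (hST ▸ Finset.mem_inter.2 ⟨hjS, hjT⟩)
      simp [Set.indicator_apply, hcc]
    · simp [hjS, hjT]
    · simp [hjS, hjT]
    · simp_all
  have hsplit : (principal A (S ∪ T)).det =
      (principal (A.updateRow c ((S : Set ι).indicator (A c))) (S ∪ T)).det +
        (principal (A.updateRow c ((T : Set ι).indicator (A c))) (S ∪ T)).det := by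
    rw [principal_updateRow A hc, principal_updateRow A hc, ← det_updateRow_add,
      ← updateRow_eq_self (principal A (S ∪ T)) ⟨c, hc⟩]
    congr 2
    · simp
    · exact funext fun j => hrow j j.2
  rw [hsplit,
    det_principal_updateRow_indicator hST fun i hi hic j hj hjc => (hA i hi hic j hj hjc).1,
    Finset.union_comm, det_principal_updateRow_indicator (Finset.inter_comm S T ▸ hST)
      fun j hj hjc i hi hic => (hA i hi hic j hj hjc).2]

/-- The matrix `A` after subtracting row `c` from all rows and the original column `c` from all
columns. When `A c c = 0` its row and column `c` vanish. -/
def reduced (A : Matrix ι ι R) (c : ι) : Matrix ι ι R :=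
  of fun i j => A i j - A i c - A c j

/-- The matrix `A` after subtracting row `c` from the other rows and column `c` from the other
columns, for `A c c = 0`: unlike `reduced A c` it keeps row and column `c`. -/
def pivoted (A : Matrix ι ι R) (c : ι) : Matrix ι ι R :=
  of fun i j => A i j - (if j = c then 0 else A i c) - if i = c then 0 else A c j

theorem det_principal_pivoted {A : Matrix ι ι R} (hc : c ∈ S) (hcc : A c c = 0) :
    (principal (pivoted A c) S).det = (principal A S).det := by
  let B : Matrix ι ι R := of fun i j => A i j - if j = c then 0 else A i c
  have hrows : (principal (pivoted A c) S).det = (principal B S).det := by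
    refine det_eq_of_forall_row_eq_smul_add_const (fun i => if (i : ι) = c then 0 else -1)
      ⟨c, hc⟩ (if_pos rfl) fun i j => ?_
    simp only [principal, pivoted, B, submatrix_apply, of_apply, hcc]
    split_ifs <;> ring
  have hcols : (principal B S)ᵀ.det = (principal A S)ᵀ.det := by
    refine det_eq_of_forall_row_eq_smul_add_const (fun j => if (j : ι) = c then 0 else -1)
      ⟨c, hc⟩ (if_pos rfl) fun j i => ?_
    simp only [principal, B, transpose_apply, submatrix_apply, of_apply]
    split_ifs <;> ring
  rw [hrows, ← det_transpose, hcols, det_transpose]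

end PrincipalSubmatrix

section CofactorSum

variable {ι κ : Type*} [Fintype ι] [DecidableEq ι] [Fintype κ] [DecidableEq κ]

theorem cof_eq_sum_det_updateRow (A : Matrix ι ι ℝ) : cof A = ∑ i, (A.updateRow i 1).det := by
  refine Finset.sum_congr rfl fun i _ => ?_
  rw [← cramer_transpose_apply, cramer_eq_adjugate_mulVec, ← adjugate_transpose]
  simp [mulVec, dotProduct]

theorem cof_submatrix_equiv (e : κ ≃ ι) (A : Matrix ι ι ℝ) : cof (A.submatrix e e) = cof A := by
  simp only [cof, adjugate_submatrix_equiv_self, submatrix_apply]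
  rw [e.sum_comp fun i => ∑ j, A.adjugate (e j) i]
  exact Finset.sum_congr rfl fun i _ => e.sum_comp fun j => A.adjugate j i

theorem cof_transpose (A : Matrix ι ι ℝ) : cof Aᵀ = cof A := by
  simp only [cof, ← adjugate_transpose, transpose_apply]
  exact Finset.sum_comm

theorem cof_sub_row_const (A : Matrix ι ι ℝ) (f : ι → ℝ) :
    cof (of fun i j => A i j - f i) = cof A := by
  rw [cof_eq_sum_det_updateRow, cof_eq_sum_det_updateRow]
  refine Finset.sum_congr rfl fun k _ =>
    det_eq_of_forall_row_eq_smul_add_const (fun i => if i = k then 0 else -f i) k (if_pos rfl)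
      fun i j => ?_
  rcases eq_or_ne i k with rfl | hik
  · simp
  · simp [hik, sub_eq_add_neg]

theorem cof_sub_col_const (A : Matrix ι ι ℝ) (g : ι → ℝ) :
    cof (of fun i j => A i j - g j) = cof A := by
  rw [← cof_transpose, ← cof_transpose A]
  exact cof_sub_row_const Aᵀ g

end CofactorSum

section CofactorPrincipal

variable {ι : Type*} [DecidableEq ι] {A : Matrix ι ι ℝ} {S T : Finset ι} {c : ι}

theorem cof_principal_eq_det_erase (hc : c ∈ S) (hrow : ∀ j, A c j = 0) (hcol : ∀ i, A i c = 0) :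
    cof (principal A S) = (principal A (S.erase c)).det := by
  have hsum : cof (principal A S) = (principal (A.updateRow c 1) S).det := by
    rw [cof_eq_sum_det_updateRow, principal_updateRow A hc]
    refine Finset.sum_eq_single_of_mem (⟨c, hc⟩ : S) (Finset.mem_univ _) fun k _ hk => ?_
    refine det_eq_zero_of_row_eq_zero ⟨c, hc⟩ fun j => ?_
    rw [updateRow_ne hk.symm]
    exact hrow j
  have hcorner : (principal (A.updateRow c 1) {c}).det = 1 := by
    rw [det_unique]
    exact congrFun updateRow_self c
  have hS : S.erase c ∪ {c} = S := by
    rw [Finset.union_comm, ← Finset.insert_eq, Finset.insert_erase hc]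
  rw [hsum, ← hS, det_principal_union_of_disjoint
    (Finset.disjoint_singleton_right.2 (Finset.notMem_erase c S)), hcorner, mul_one, hS]
  · congr 1
    exact principal_congr fun i hi j _ => congrFun (updateRow_ne (Finset.ne_of_mem_erase hi)) j
  · intro i hi j hj
    rw [Finset.mem_singleton.1 hj, updateRow_ne (Finset.ne_of_mem_erase hi), hcol]

theorem cof_principal_eq_det_reduced (hc : c ∈ S) (hcc : A c c = 0) :
    cof (principal A S) = (principal (reduced A c) (S.erase c)).det := by
  calc cof (principal A S)
      = cof (of fun i j : S => principal A S i j - A i c) := (cof_sub_row_const _ _).symm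
    _ = cof (principal (reduced A c) S) := (cof_sub_col_const _ fun j : S => A c j).symm
    _ = _ := cof_principal_eq_det_erase hc (by simp [reduced, hcc]) (by simp [reduced, hcc])

theorem cof_principal_union (hST : S ∩ T = {c})
    (hA : ∀ x ∈ S, ∀ y ∈ T, A x y = A x c + A c y ∧ A y x = A y c + A c x) :
    cof (principal A (S ∪ T)) = cof (principal A S) * cof (principal A T) := by
  obtain ⟨hcS, hcT⟩ := Finset.mem_inter.1 (hST ▸ Finset.mem_singleton_self c)
  have hcc : A c c = 0 := left_eq_add.1 (hA c hcS c hcT).1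
  have hdisj : Disjoint (S.erase c) (T.erase c) := by
    rw [Finset.disjoint_iff_inter_eq_empty, Finset.inter_erase, Finset.erase_inter, hST]
    simp
  rw [cof_principal_eq_det_reduced (Finset.mem_union_left T hcS) hcc,
    cof_principal_eq_det_reduced hcS hcc, cof_principal_eq_det_reduced hcT hcc,
    Finset.erase_union_distrib, det_principal_union_of_disjoint hdisj]
  intro x hx y hy
  have hxy := (hA x (Finset.mem_of_mem_erase hx) y (Finset.mem_of_mem_erase hy)).1
  simp [reduced, hxy]

theorem det_principal_union (hST : S ∩ T = {c})
    (hA : ∀ x ∈ S, ∀ y ∈ T, A x y = A x c + A c y ∧ A y x = A y c + A c x) :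
    (principal A (S ∪ T)).det = (principal A S).det * cof (principal A T) +
      (principal A T).det * cof (principal A S) := by
  obtain ⟨hcS, hcT⟩ := Finset.mem_inter.1 (hST ▸ Finset.mem_singleton_self c)
  have hcc : A c c = 0 := left_eq_add.1 (hA c hcS c hcT).1
  have hcof (U : Finset ι) (hcU : c ∈ U) :
      cof (principal A U) = (principal (pivoted A c) (U.erase c)).det := by
    rw [cof_principal_eq_det_reduced hcU hcc]
    congr 1
    refine principal_congr fun i hi j hj => ?_
    simp [reduced, pivoted, Finset.ne_of_mem_erase hi, Finset.ne_of_mem_erase hj]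
  rw [hcof S hcS, hcof T hcT, ← det_principal_pivoted (Finset.mem_union_left T hcS) hcc,
    ← det_principal_pivoted hcS hcc, ← det_principal_pivoted hcT hcc]
  refine det_principal_union_of_inter_eq_singleton hST (by simp [pivoted, hcc]) ?_
  intro x hx hxc y hy hyc
  simp [pivoted, hxc, hyc, hA x hx y hy]

end CofactorPrincipal

/-! ### Paths and distances across a separating vertex -/

section Paths

variable {V : Type*} {G : Digraph V} {W : V → V → ℝ} {S S₁ S₂ : Finset V} {l p q : List V}
  {x y c : V}

theorem pathWeight_map {X : Type*} (f : X → V) (l : List X) :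
    pathWeight W (l.map f) = pathWeight (fun u v => W (f u) (f v)) l := by
  induction l with
  | nil => rfl
  | cons u l ih =>
    cases l with
    | nil => rfl
    | cons v l => exact congrArg (W (f u) (f v) + ·) ih

theorem pathWeight_append_cons (p q : List V) (c : V) :
    pathWeight W (p ++ c :: q) = pathWeight W (p ++ [c]) + pathWeight W (c :: q) := by
  induction p with
  | nil => simp [pathWeight]
  | cons u p ih =>
    cases p with
    | nil => simp [pathWeight]
    | cons v p =>
      simp only [List.cons_append, pathWeight] at ih ⊢
      rw [ih, add_assoc]

theorem isDirPath_append_cons_iff :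
    IsDirPath G (p ++ c :: q) x y ↔
      IsDirPath G (p ++ [c]) x c ∧ IsDirPath G (c :: q) c y ∧ p.Disjoint q := by
  have hhead : (p ++ c :: q).head? = (p ++ [c]).head? := by cases p <;> rfl
  have hlast : (p ++ c :: q).getLast? = (c :: q).getLast? := List.getLast?_append_cons ..
  have hnodup : (p ++ c :: q).Nodup ↔ (p ++ [c]).Nodup ∧ (c :: q).Nodup ∧ p.Disjoint q := by
    simp only [List.nodup_append', List.nodup_cons, List.disjoint_cons_right,
      List.disjoint_nil_right, List.not_mem_nil, not_false_eq_true, List.nodup_nil, and_true,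
      true_and]
    tauto
  constructor
  · rintro ⟨hx, hy, hchain, hl⟩
    obtain ⟨hchainp, hchainq⟩ := List.isChain_split.1 hchain
    obtain ⟨hp, hq, hpq⟩ := hnodup.1 hl
    exact ⟨⟨hhead ▸ hx, by simp, hchainp, hp⟩, ⟨rfl, hlast ▸ hy, hchainq, hq⟩, hpq⟩
  · rintro ⟨hp, hq, hpq⟩
    exact ⟨hhead ▸ hp.head_eq, hlast ▸ hq.last_eq, List.isChain_split.2 ⟨hp.chain, hq.chain⟩,
      hnodup.2 ⟨hp.nodup, hq.nodup, hpq⟩⟩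

theorem isDirPath_induced_iff {l : List S} {x y : S} :
    IsDirPath (induced G S) l x y ↔ IsDirPath G (l.map (↑)) x y := by
  have hinj := Option.map_injective (Subtype.val_injective (p := (· ∈ S)))
  have hhead : (l.map (↑)).head? = some (x : V) ↔ l.head? = some x := by
    rw [List.head?_map, ← Option.map_some, hinj.eq_iff]
  have hlast : (l.map (↑)).getLast? = some (y : V) ↔ l.getLast? = some y := by
    rw [List.getLast?_map, ← Option.map_some, hinj.eq_iff]
  have hchain : (l.map (↑)).IsChain G.Adj ↔ l.IsChain (induced G S).Adj := List.isChain_map _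
  exact ⟨fun h => ⟨hhead.2 h.head_eq, hlast.2 h.last_eq, hchain.2 h.chain,
      h.nodup.map Subtype.val_injective⟩,
    fun h => ⟨hhead.1 h.head_eq, hlast.1 h.last_eq, hchain.1 h.chain, .of_map _ h.nodup⟩⟩

variable (G) in
/-- `l` is a directed path of `G` from `x` to `y` all of whose vertices lie in `S`. -/
def IsPathIn (S : Finset V) (l : List V) (x y : V) : Prop :=
  IsDirPath G l x y ∧ ∀ v ∈ l, v ∈ S

theorem exists_isPathIn_iff {P : List V → Prop} {x y : S} :
    (∃ l, IsPathIn G S l x y ∧ P l) ↔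
      ∃ l : List S, IsDirPath (induced G S) l x y ∧ P (l.map (↑)) := by
  constructor
  · rintro ⟨l, ⟨hl, hS⟩, hP⟩
    lift l to List S using hS
    exact ⟨l, isDirPath_induced_iff.2 hl, hP⟩
  · rintro ⟨l, hl, hP⟩
    exact ⟨l.map (↑), ⟨isDirPath_induced_iff.1 hl, by simp +contextual⟩, hP⟩

theorem stronglyConnected_induced_iff :
    StronglyConnected (induced G S) ↔
      S.Nonempty ∧ ∀ x ∈ S, ∀ y ∈ S, ∃ l, IsPathIn G S l x y := by
  rw [StronglyConnected, Finset.nonempty_coe_sort]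
  refine and_congr_right fun _ => ?_
  simp only [Subtype.forall]
  refine forall₂_congr fun x hx => forall₂_congr fun y hy => ?_
  simpa only [and_true] using
    (exists_isPathIn_iff (P := fun _ => True) (x := ⟨x, hx⟩) (y := ⟨y, hy⟩)).symm

variable (G W) in
/-- The set of weights of the directed paths from `x` to `y` inside `S`. -/
def pathWeights (S : Finset V) (x y : V) : Set ℝ :=
  {w | ∃ l, IsPathIn G S l x y ∧ pathWeight W l = w}

variable (G W) in
/-- The matrix of distances measured inside `S`, indexed by all vertices so that the matrices for
different `S` can be compared; only its principal submatrix on `S` is meaningful. -/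
noncomputable def distIn (S : Finset V) : Matrix V V ℝ :=
  of fun x y => sInf (pathWeights G W S x y)

theorem blockMatrix_eq_principal : blockMatrix G W S = principal (distIn G W S) S := by
  ext x y
  refine congrArg sInf (Set.ext fun w => ?_)
  refine Iff.trans ?_ (exists_isPathIn_iff (P := fun l => pathWeight W l = w)).symm
  simp only [pathWeight_map]
  rfl

theorem distMatrix_eq_distIn_univ [Fintype V] : distMatrix G W = distIn G W Finset.univ := by
  simp [distMatrix, distIn, pathWeights, IsPathIn]

theorem pathWeights_finite : (pathWeights G W S x y).Finite := by
  classical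
  have hfin : {l : List S | l.Nodup}.Finite :=
    Set.finite_coe_iff.1 (inferInstanceAs (Finite {l : List S // l.Nodup}))
  refine (hfin.image fun l => pathWeight W (l.map (↑))).subset ?_
  rintro w ⟨l, ⟨hl, hS⟩, rfl⟩
  lift l to List S using hS
  exact ⟨l, .of_map _ hl.nodup, rfl⟩

variable [DecidableEq V]

variable (G) in
/-- The vertex sets `S₁` and `S₂` share exactly the vertex `c`, and every edge between them
is incident with `c`. -/
structure IsSeparation (S₁ S₂ : Finset V) (c : V) : Prop where
  inter_eq : S₁ ∩ S₂ = {c}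
  not_adj : ∀ u ∈ S₁, ∀ v ∈ S₂, u ≠ c → v ≠ c → ¬ G.toSimpleGraphInclusive.Adj u v

namespace IsSeparation

theorem symm (h : IsSeparation G S₁ S₂ c) : IsSeparation G S₂ S₁ c where
  inter_eq := by rw [Finset.inter_comm, h.inter_eq]
  not_adj u hu v hv huc hvc huv := h.not_adj v hv u hu hvc huc huv.symm

theorem mem_left (h : IsSeparation G S₁ S₂ c) : c ∈ S₁ :=
  (Finset.mem_inter.1 (h.inter_eq ▸ Finset.mem_singleton_self c)).1

theorem eq_of_mem (h : IsSeparation G S₁ S₂ c) (hx₁ : x ∈ S₁) (hx₂ : x ∈ S₂) : x = c :=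
  Finset.mem_singleton.1 (h.inter_eq ▸ Finset.mem_inter.2 ⟨hx₁, hx₂⟩)

theorem mem_left_of_adj (h : IsSeparation G S₁ S₂ c) (hxy : G.toSimpleGraphInclusive.Adj x y)
    (hxc : x ≠ c) (hyc : y ≠ c) (hx : x ∈ S₁) (hy : y ∈ S₁ ∪ S₂) : y ∈ S₁ :=
  (Finset.mem_union.1 hy).resolve_right fun hy₂ => h.not_adj x hx y hy₂ hxc hyc hxy

theorem forall_mem_left_of_notMem (h : IsSeparation G S₁ S₂ c) (hl : l.IsChain G.Adj)
    (hS : ∀ v ∈ l, v ∈ S₁ ∪ S₂) (hc : c ∉ l) (hx : x ∈ l) (hx₁ : x ∈ S₁) : ∀ v ∈ l, v ∈ S₁ := by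
  let SameSide (u v : V) : Prop := u ∈ S₁ ↔ v ∈ S₁
  have : Trans SameSide SameSide SameSide := ⟨Iff.trans⟩
  have : Std.Symm SameSide := ⟨fun _ _ => Iff.symm⟩
  have hside : l.IsChain SameSide := hl.imp_of_mem_imp fun u v hu hv huv => by
    rcases eq_or_ne u v with rfl | hne
    · exact Iff.rfl
    · have hadj : G.toSimpleGraphInclusive.Adj u v := ⟨hne, .inl huv⟩
      have huc : u ≠ c := ne_of_mem_of_not_mem hu hc
      have hvc : v ≠ c := ne_of_mem_of_not_mem hv hc
      exact ⟨fun h₁ => h.mem_left_of_adj hadj huc hvc h₁ (hS v hv),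
        fun h₁ => h.mem_left_of_adj hadj.symm hvc huc h₁ (hS u hu)⟩
  exact fun v hv =>
    (hside.pairwise.forall_of_forall (R := SameSide) (fun _ _ => Iff.rfl) hx hv).1 hx₁

theorem isPathIn_left_iff (h : IsSeparation G S₁ S₂ c) (hx : x ∈ S₁) (hy : y ∈ S₁) :
    IsPathIn G (S₁ ∪ S₂) l x y ↔ IsPathIn G S₁ l x y := by
  refine ⟨fun ⟨hl, hS⟩ => ⟨hl, ?_⟩,
    fun ⟨hl, hS⟩ => ⟨hl, fun v hv => Finset.mem_union_left _ (hS v hv)⟩⟩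
  by_cases hc : c ∈ l
  · obtain ⟨p, q, rfl⟩ := List.append_of_mem hc
    obtain ⟨hp, hq, -⟩ := isDirPath_append_cons_iff.1 hl
    simp only [List.forall_mem_append, List.forall_mem_cons] at hS ⊢
    refine ⟨?_, h.mem_left, ?_⟩
    · rcases p with - | ⟨u, p⟩
      · simp
      · obtain rfl : u = x := by simpa using hp.head_eq
        exact h.forall_mem_left_of_notMem hp.chain.left_of_append hS.1
          (List.disjoint_singleton.1 (List.disjoint_of_nodup_append hp.nodup)) (by simp) hx
    · rcases q with - | ⟨u, q⟩
      · simp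
      · have hyq : y ∈ u :: q :=
          List.mem_of_getLast? (by rw [← hq.last_eq, List.getLast?_cons_cons])
        exact h.forall_mem_left_of_notMem hq.chain.tail hS.2.2 (List.nodup_cons.1 hq.nodup).1
          hyq hy
  · exact h.forall_mem_left_of_notMem hl.chain hS hc (List.mem_of_head? hl.head_eq) hx

theorem stronglyConnected_left (h : IsSeparation G S₁ S₂ c)
    (hS : StronglyConnected (induced G (S₁ ∪ S₂))) : StronglyConnected (induced G S₁) := by
  rw [stronglyConnected_induced_iff] at hS ⊢
  refine ⟨⟨c, h.mem_left⟩, fun x hx y hy => ?_⟩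
  obtain ⟨l, hl⟩ := hS.2 x (Finset.mem_union_left _ hx) y (Finset.mem_union_left _ hy)
  exact ⟨l, (h.isPathIn_left_iff hx hy).1 hl⟩

theorem stronglyConnected_right (h : IsSeparation G S₁ S₂ c)
    (hS : StronglyConnected (induced G (S₁ ∪ S₂))) : StronglyConnected (induced G S₂) :=
  h.symm.stronglyConnected_left (by rwa [Finset.union_comm])

theorem isPathIn_append_cons_iff (h : IsSeparation G S₁ S₂ c) (hx : x ∈ S₁) (hy : y ∈ S₂) :
    IsPathIn G (S₁ ∪ S₂) (p ++ c :: q) x y ↔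
      IsPathIn G S₁ (p ++ [c]) x c ∧ IsPathIn G S₂ (c :: q) c y := by
  constructor
  · intro ⟨hl, hS⟩
    obtain ⟨hp, hq, -⟩ := isDirPath_append_cons_iff.1 hl
    rw [List.forall_mem_append] at hS
    rw [← h.isPathIn_left_iff hx h.mem_left, ← h.symm.isPathIn_left_iff h.symm.mem_left hy,
      Finset.union_comm S₂]
    exact ⟨⟨hp, List.forall_mem_append.2 ⟨hS.1, by simpa using (List.forall_mem_cons.1 hS.2).1⟩⟩,
      hq, hS.2⟩
  · intro ⟨⟨hp, hpS⟩, ⟨hq, hqS⟩⟩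
    rw [List.forall_mem_append] at hpS
    have hcp : c ∉ p := List.disjoint_singleton.1 (List.disjoint_of_nodup_append hp.nodup)
    have hpq : p.Disjoint q := fun v hvp hvq =>
      hcp (h.eq_of_mem (hpS.1 v hvp) (hqS v (List.mem_cons_of_mem c hvq)) ▸ hvp)
    exact ⟨isDirPath_append_cons_iff.2 ⟨hp, hq, hpq⟩, List.forall_mem_append.2
      ⟨fun v hv => Finset.mem_union_left _ (hpS.1 v hv),
        fun v hv => Finset.mem_union_right _ (hqS v hv)⟩⟩

theorem mem_of_isPathIn (h : IsSeparation G S₁ S₂ c) (hl : IsPathIn G (S₁ ∪ S₂) l x y)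
    (hx : x ∈ S₁) (hy : y ∈ S₂) : c ∈ l := by
  by_contra hc
  have hyl : y ∈ l := List.mem_of_getLast? hl.1.last_eq
  have hy₁ : y ∈ S₁ :=
    h.forall_mem_left_of_notMem hl.1.chain hl.2 hc (List.mem_of_head? hl.1.head_eq) hx y hyl
  exact hc (h.eq_of_mem hy₁ hy ▸ hyl)

theorem distIn_left (h : IsSeparation G S₁ S₂ c) (hx : x ∈ S₁) (hy : y ∈ S₁) :
    distIn G W (S₁ ∪ S₂) x y = distIn G W S₁ x y := by
  simp only [distIn, of_apply, pathWeights, h.isPathIn_left_iff hx hy]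

theorem principal_distIn_left (h : IsSeparation G S₁ S₂ c) :
    principal (distIn G W (S₁ ∪ S₂)) S₁ = blockMatrix G W S₁ := by
  rw [blockMatrix_eq_principal]
  exact principal_congr fun x hx y hy => h.distIn_left hx hy

theorem principal_distIn_right (h : IsSeparation G S₁ S₂ c) :
    principal (distIn G W (S₁ ∪ S₂)) S₂ = blockMatrix G W S₂ := by
  rw [Finset.union_comm, h.symm.principal_distIn_left]

open scoped Pointwise in
theorem pathWeights_cross (h : IsSeparation G S₁ S₂ c) (hx : x ∈ S₁) (hy : y ∈ S₂) :
    pathWeights G W (S₁ ∪ S₂) x y = pathWeights G W S₁ x c + pathWeights G W S₂ c y := by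
  ext w
  constructor
  · rintro ⟨l, hl, rfl⟩
    obtain ⟨p, q, rfl⟩ := List.append_of_mem (h.mem_of_isPathIn hl hx hy)
    obtain ⟨hp, hq⟩ := (h.isPathIn_append_cons_iff hx hy).1 hl
    exact ⟨_, ⟨_, hp, rfl⟩, _, ⟨_, hq, rfl⟩, (pathWeight_append_cons p q c).symm⟩
  · rintro ⟨_, ⟨l₁, hl₁, rfl⟩, _, ⟨l₂, hl₂, rfl⟩, rfl⟩
    obtain ⟨p, rfl⟩ := List.getLast?_eq_some_iff.1 hl₁.1.last_eq
    obtain ⟨q, rfl⟩ := List.head?_eq_some_iff.1 hl₂.1.head_eq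
    exact ⟨_, (h.isPathIn_append_cons_iff hx hy).2 ⟨hl₁, hl₂⟩, pathWeight_append_cons p q c⟩

theorem distIn_cross (h : IsSeparation G S₁ S₂ c) (hS : StronglyConnected (induced G (S₁ ∪ S₂)))
    (hx : x ∈ S₁) (hy : y ∈ S₂) :
    distIn G W (S₁ ∪ S₂) x y = distIn G W (S₁ ∪ S₂) x c + distIn G W (S₁ ∪ S₂) c y := by
  obtain ⟨l₁, hl₁⟩ :=
    (stronglyConnected_induced_iff.1 (h.stronglyConnected_left hS)).2 x hx c h.mem_left
  obtain ⟨l₂, hl₂⟩ :=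
    (stronglyConnected_induced_iff.1 (h.stronglyConnected_right hS)).2 c h.symm.mem_left y hy
  rw [h.distIn_left hx h.mem_left, Finset.union_comm, h.symm.distIn_left h.symm.mem_left hy,
    Finset.union_comm]
  simp only [distIn, of_apply, h.pathWeights_cross hx hy]
  exact csInf_add ⟨_, l₁, hl₁, rfl⟩ pathWeights_finite.bddBelow ⟨_, l₂, hl₂, rfl⟩
    pathWeights_finite.bddBelow

theorem distIn_additive (h : IsSeparation G S₁ S₂ c)
    (hS : StronglyConnected (induced G (S₁ ∪ S₂))) :
    ∀ x ∈ S₁, ∀ y ∈ S₂,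
      distIn G W (S₁ ∪ S₂) x y = distIn G W (S₁ ∪ S₂) x c + distIn G W (S₁ ∪ S₂) c y ∧
      distIn G W (S₁ ∪ S₂) y x = distIn G W (S₁ ∪ S₂) y c + distIn G W (S₁ ∪ S₂) c x := by
  refine fun x hx y hy => ⟨h.distIn_cross hS hx hy, ?_⟩
  rw [Finset.union_comm] at hS ⊢
  exact h.symm.distIn_cross hS hy hx

theorem cof_blockMatrix_union (h : IsSeparation G S₁ S₂ c)
    (hS : StronglyConnected (induced G (S₁ ∪ S₂))) :
    cof (blockMatrix G W (S₁ ∪ S₂)) = cof (blockMatrix G W S₁) * cof (blockMatrix G W S₂) := by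
  rw [blockMatrix_eq_principal, cof_principal_union h.inter_eq (h.distIn_additive hS),
    h.principal_distIn_left, h.principal_distIn_right]

theorem det_blockMatrix_union (h : IsSeparation G S₁ S₂ c)
    (hS : StronglyConnected (induced G (S₁ ∪ S₂))) :
    (blockMatrix G W (S₁ ∪ S₂)).det =
      (blockMatrix G W S₁).det * cof (blockMatrix G W S₂) +
        (blockMatrix G W S₂).det * cof (blockMatrix G W S₁) := by
  rw [blockMatrix_eq_principal, det_principal_union h.inter_eq (h.distIn_additive hS),
    h.principal_distIn_left, h.principal_distIn_right]

end IsSeparation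

end Paths

/-! ### Decomposition into blocks -/

theorem sum_mul_prod_erase_union {ι R : Type*} [DecidableEq ι] [CommSemiring R] {s t : Finset ι}
    (hst : Disjoint s t) (a f : ι → R) :
    ∑ i ∈ s ∪ t, a i * ∏ j ∈ (s ∪ t).erase i, f j =
      (∑ i ∈ s, a i * ∏ j ∈ s.erase i, f j) * ∏ j ∈ t, f j +
        (∑ i ∈ t, a i * ∏ j ∈ t.erase i, f j) * ∏ j ∈ s, f j := by
  rw [Finset.sum_union hst, Finset.sum_mul, Finset.sum_mul]
  congr 1 <;> refine Finset.sum_congr rfl fun i hi => ?_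
  · rw [Finset.erase_union_distrib, Finset.erase_eq_of_notMem (Finset.disjoint_left.1 hst hi),
      Finset.prod_union (hst.mono_left (Finset.erase_subset i s)), mul_assoc]
  · rw [Finset.erase_union_distrib, Finset.erase_eq_of_notMem (Finset.disjoint_right.1 hst hi),
      Finset.prod_union (hst.mono_right (Finset.erase_subset i t)), mul_assoc,
      mul_comm (∏ j ∈ s, _)]

section Blocks

variable {V : Type*} {G : Digraph V} {W : V → V → ℝ} {S S₁ S₂ B : Finset V} {c : V}

theorem StronglyConnected.connected_toSimpleGraphInclusive (hG : StronglyConnected G) :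
    G.toSimpleGraphInclusive.Connected := by
  have : Nonempty V := hG.1
  refine .mk fun x y => ?_
  obtain ⟨l, hl⟩ := hG.2 x y
  obtain ⟨q, rfl⟩ := List.head?_eq_some_iff.1 hl.head_eq
  have hreach (v : V) (hv : v ∈ x :: q) : G.toSimpleGraphInclusive.Reachable x v := by
    refine hl.chain.induction (G.toSimpleGraphInclusive.Reachable x) _ (fun u v huv hu => ?_)
      (fun _ => .rfl) v hv
    rcases eq_or_ne u v with rfl | hne
    · exact hu
    · exact hu.trans (SimpleGraph.Adj.reachable ⟨hne, .inl huv⟩)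
  exact hreach y (List.mem_of_getLast? hl.last_eq)

theorem StronglyConnected.connected_induce (hS : StronglyConnected (induced G S)) :
    (G.toSimpleGraphInclusive.induce (S : Set V)).Connected := by
  have heq : G.toSimpleGraphInclusive.induce (S : Set V) =
      (induced G S).toSimpleGraphInclusive := by
    ext u v
    exact and_congr_left' (not_congr Subtype.ext_iff.symm)
  exact heq ▸ hS.connected_toSimpleGraphInclusive

variable (G) in
/-- `B` is the vertex set of a block of the subgraph induced on `S`. -/
def IsBlockOf (S B : Finset V) : Prop :=
  Maximal (fun B => ConnectedNoCutVertex G B ∧ B ⊆ S) B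

theorem IsBlockOf.of_subset {T : Finset V} (hB : IsBlockOf G T B) (hST : S ⊆ T)
    (hBS : B ⊆ S) : IsBlockOf G S B :=
  hB.mono (fun _ h => ⟨h.1, h.2.trans hST⟩) ⟨hB.prop.1, hBS⟩

theorem connectedNoCutVertex_pair [DecidableEq V] {u v : V}
    (huv : G.toSimpleGraphInclusive.Adj u v) : ConnectedNoCutVertex G {u, v} := by
  rw [ConnectedNoCutVertex, Finset.coe_pair]
  refine ⟨SimpleGraph.induce_pair_connected_of_adj huv, fun w hw => ?_⟩
  have : Subsingleton ↥(({u, v} : Set V) \ {w}) := by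
    rcases Finset.mem_insert.1 hw with rfl | hw
    · exact (Set.subsingleton_singleton (a := v)).anti (by grind) |>.coe_sort
    · exact (Set.subsingleton_singleton (a := u)).anti (by grind) |>.coe_sort
  exact .of_subsingleton

theorem IsBlockOf.nontrivial (hB : IsBlockOf G S B)
    (hS : (G.toSimpleGraphInclusive.induce (S : Set V)).Connected) (hnt : S.Nontrivial) :
    B.Nontrivial := by
  classical
  obtain ⟨v, hv⟩ : B.Nonempty := Finset.nonempty_coe_sort.1 hB.prop.1.1.nonempty
  have hvS : v ∈ S := hB.prop.2 hv
  have : Nontrivial (S : Set V) := Set.nontrivial_coe_sort.2 hnt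
  obtain ⟨⟨u, huS⟩, hvu⟩ := hS.preconnected.exists_adj_of_nontrivial ⟨v, hvS⟩
  refine (B.eq_singleton_or_nontrivial hv).resolve_left ?_
  rintro rfl
  have hsub : ({v, u} : Finset V) ⊆ S := by grind
  have hle : ({v, u} : Finset V) ⊆ {v} :=
    hB.le_of_ge ⟨connectedNoCutVertex_pair hvu, hsub⟩ (by simp)
  exact hvu.ne' (Subtype.ext (Finset.mem_singleton.1 (hle (by simp))))

open scoped Classical in
variable (G) in
/-- The vertex sets of the blocks of the subgraph induced on `S`. -/
noncomputable def blocksOf (S : Finset V) : Finset (Finset V) :=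
  S.powerset.filter (IsBlockOf G S)

theorem mem_blocksOf : B ∈ blocksOf G S ↔ IsBlockOf G S B := by
  simpa [blocksOf] using fun hB : IsBlockOf G S B => hB.prop.2

theorem blocksOf_univ [Fintype V] : blocksOf G Finset.univ = blocks G := by
  ext B
  simp [blocksOf, blocks, IsBlockOf, IsBlock]

theorem blocksOf_eq_singleton (hS : ConnectedNoCutVertex G S) : blocksOf G S = {S} := by
  ext B
  rw [mem_blocksOf, Finset.mem_singleton]
  constructor
  · exact fun hB => hB.eq_of_le ⟨hS, subset_rfl⟩ hB.prop.2
  · rintro rfl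
    exact ⟨⟨hS, subset_rfl⟩, fun _ h _ => h.2⟩

variable [DecidableEq V]

namespace IsSeparation

theorem left_ssubset_union (h : IsSeparation G S₁ S₂ c) (hnt : S₂.Nontrivial) :
    S₁ ⊂ S₁ ∪ S₂ := by
  obtain ⟨y, hy, hyc⟩ := hnt.exists_ne c
  exact Finset.ssubset_iff_subset_ne.2 ⟨Finset.subset_union_left, fun heq =>
    hyc (h.eq_of_mem (heq ▸ Finset.mem_union_right S₁ hy) hy)⟩

theorem right_ssubset_union (h : IsSeparation G S₁ S₂ c) (hnt : S₁.Nontrivial) :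
    S₂ ⊂ S₁ ∪ S₂ := by
  rw [Finset.union_comm]
  exact h.symm.left_ssubset_union hnt

theorem subset_or_subset (h : IsSeparation G S₁ S₂ c) (hB : ConnectedNoCutVertex G B)
    (hBS : B ⊆ S₁ ∪ S₂) : B ⊆ S₁ ∨ B ⊆ S₂ := by
  by_contra! hcon
  obtain ⟨⟨x, hxB, hx₁⟩, ⟨y, hyB, hy₂⟩⟩ := hcon.imp Finset.not_subset.1 Finset.not_subset.1
  have hx₂ : x ∈ S₂ := (Finset.mem_union.1 (hBS hxB)).resolve_left hx₁
  have hxc : x ≠ c := fun e => hx₁ (e ▸ h.mem_left)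
  have hyc : y ≠ c := fun e => hy₂ (e ▸ h.symm.mem_left)
  have hconn : (G.toSimpleGraphInclusive.induce ((B : Set V) \ {c})).Preconnected := by
    by_cases hc : c ∈ B
    · exact hB.2 c hc
    · rw [Set.sdiff_singleton_eq_self (by simpa using hc)]
      exact hB.1.preconnected
  obtain ⟨p⟩ := hconn ⟨x, hxB, hxc⟩ ⟨y, hyB, hyc⟩
  obtain ⟨⟨⟨u, v⟩, huv⟩, -, hu, hv⟩ := p.exists_boundary_dart {z | (z : V) ∈ S₂} hx₂ hy₂
  have hvS : (v : V) ∈ S₂ ∪ S₁ := Finset.union_comm S₁ S₂ ▸ hBS v.2.1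
  exact hv (h.symm.mem_left_of_adj huv u.2.2 v.2.2 hu hvS)

theorem not_subset_right (h : IsSeparation G S₁ S₂ c) (hB : B.Nontrivial) (hB₁ : B ⊆ S₁) :
    ¬ B ⊆ S₂ := by
  obtain ⟨v, hv, hvc⟩ := hB.exists_ne c
  exact fun hB₂ => hvc (h.eq_of_mem (hB₁ hv) (hB₂ hv))

theorem isBlockOf_union_of_left (h : IsSeparation G S₁ S₂ c) (hB : IsBlockOf G S₁ B)
    (hnt : B.Nontrivial) : IsBlockOf G (S₁ ∪ S₂) B := by
  refine ⟨⟨hB.prop.1, hB.prop.2.trans Finset.subset_union_left⟩, fun B' hB' hBB' => ?_⟩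
  rcases h.subset_or_subset hB'.1 hB'.2 with h' | h'
  · exact hB.le_of_ge ⟨hB'.1, h'⟩ hBB'
  · exact absurd (hBB'.trans h') (h.not_subset_right hnt hB.prop.2)

end IsSeparation

theorem exists_isSeparation (hS : (G.toSimpleGraphInclusive.induce (S : Set V)).Connected)
    (hcut : ¬ ConnectedNoCutVertex G S) :
    ∃ S₁ S₂ c, IsSeparation G S₁ S₂ c ∧ S₁.Nontrivial ∧ S₂.Nontrivial ∧ S₁ ∪ S₂ = S := by
  classical
  obtain ⟨c, hc, x, y, hxy⟩ : ∃ c ∈ S, ∃ x y,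
      ¬ (G.toSimpleGraphInclusive.induce ((S : Set V) \ {c})).Reachable x y := by
    rw [ConnectedNoCutVertex, not_and] at hcut
    simpa only [SimpleGraph.Preconnected, not_forall, exists_prop] using hcut hS
  set H := G.toSimpleGraphInclusive.induce ((S : Set V) \ {c})
  let T : Finset V := S.filter fun z => ∃ hz, H.Reachable x ⟨z, hz⟩
  have hcT : c ∉ T := by simp [T]
  have hxT : (x : V) ∈ T := Finset.mem_filter.2 ⟨x.2.1, x.2, .rfl⟩
  have hyT : (y : V) ∉ T := fun hy => hxy (Finset.mem_filter.1 hy).2.2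
  have hsep : IsSeparation G (insert c T) (S \ T) c := by
    refine ⟨by grind, fun u hu v hv huc hvc huv => ?_⟩
    obtain ⟨-, hu', hxu⟩ := Finset.mem_filter.1 (Finset.mem_of_mem_insert_of_ne hu huc)
    obtain ⟨hvS, hvT⟩ := Finset.mem_sdiff.1 hv
    have hadj : H.Adj ⟨u, hu'⟩ ⟨v, hvS, hvc⟩ := huv
    exact hvT (Finset.mem_filter.2 ⟨hvS, _, hxu.trans hadj.reachable⟩)
  refine ⟨insert c T, S \ T, c, hsep, ?_, ?_, by grind⟩
  · exact ⟨c, by simp, x, by simp [hxT], Ne.symm x.2.2⟩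
  · exact ⟨c, by simp [hc, hcT], y, Finset.mem_sdiff.2 ⟨y.2.1, hyT⟩, Ne.symm y.2.2⟩

theorem induction_on_separation {P : Finset V → Prop}
    (block : ∀ S, ConnectedNoCutVertex G S → P S)
    (glue : ∀ S₁ S₂ c, IsSeparation G S₁ S₂ c → StronglyConnected (induced G (S₁ ∪ S₂)) →
      S₁.Nontrivial → S₂.Nontrivial → P S₁ → P S₂ → P (S₁ ∪ S₂))
    (hS : StronglyConnected (induced G S)) : P S := by
  induction S using Finset.strongInduction with
  | H S ih =>
    by_cases hcut : ConnectedNoCutVertex G S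
    · exact block S hcut
    · obtain ⟨S₁, S₂, c, h, hnt₁, hnt₂, rfl⟩ := exists_isSeparation hS.connected_induce hcut
      exact glue S₁ S₂ c h hS hnt₁ hnt₂
        (ih S₁ (h.left_ssubset_union hnt₂) (h.stronglyConnected_left hS))
        (ih S₂ (h.right_ssubset_union hnt₁) (h.stronglyConnected_right hS))

namespace IsSeparation

theorem blocksOf_union (h : IsSeparation G S₁ S₂ c)
    (hS : StronglyConnected (induced G (S₁ ∪ S₂))) (hnt₁ : S₁.Nontrivial)
    (hnt₂ : S₂.Nontrivial) : blocksOf G (S₁ ∪ S₂) = blocksOf G S₁ ∪ blocksOf G S₂ := by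
  ext B
  rw [Finset.mem_union, mem_blocksOf, mem_blocksOf, mem_blocksOf]
  constructor
  · exact fun hB => (h.subset_or_subset hB.prop.1 hB.prop.2).imp
      (hB.of_subset Finset.subset_union_left) (hB.of_subset Finset.subset_union_right)
  · rintro (hB | hB)
    · exact h.isBlockOf_union_of_left hB
        (hB.nontrivial (h.stronglyConnected_left hS).connected_induce hnt₁)
    · rw [Finset.union_comm]
      exact h.symm.isBlockOf_union_of_left hB
        (hB.nontrivial (h.stronglyConnected_right hS).connected_induce hnt₂)

theorem disjoint_blocksOf (h : IsSeparation G S₁ S₂ c)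
    (hS : StronglyConnected (induced G (S₁ ∪ S₂))) (hnt : S₁.Nontrivial) :
    Disjoint (blocksOf G S₁) (blocksOf G S₂) := by
  refine Finset.disjoint_left.2 fun B hB₁ hB₂ => ?_
  rw [mem_blocksOf] at hB₁ hB₂
  have hB : B.Nontrivial := hB₁.nontrivial (h.stronglyConnected_left hS).connected_induce hnt
  exact h.not_subset_right hB hB₁.prop.2 hB₂.prop.2

end IsSeparation

theorem cof_blockMatrix_eq_prod (hS : StronglyConnected (induced G S)) :
    cof (blockMatrix G W S) = ∏ B ∈ blocksOf G S, cof (blockMatrix G W B) := by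
  refine induction_on_separation
    (P := fun S => cof (blockMatrix G W S) = ∏ B ∈ blocksOf G S, cof (blockMatrix G W B))
    (fun S hcut => ?_) (fun S₁ S₂ c h hS hnt₁ hnt₂ ih₁ ih₂ => ?_) hS
  · rw [blocksOf_eq_singleton hcut, Finset.prod_singleton]
  · rw [h.cof_blockMatrix_union hS, ih₁, ih₂, h.blocksOf_union hS hnt₁ hnt₂,
      Finset.prod_union (h.disjoint_blocksOf hS hnt₁)]

theorem det_blockMatrix_eq_sum (hS : StronglyConnected (induced G S)) :
    (blockMatrix G W S).det = ∑ B ∈ blocksOf G S,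
      (blockMatrix G W B).det * ∏ B' ∈ (blocksOf G S).erase B, cof (blockMatrix G W B') := by
  refine induction_on_separation
    (P := fun S => (blockMatrix G W S).det = ∑ B ∈ blocksOf G S,
      (blockMatrix G W B).det * ∏ B' ∈ (blocksOf G S).erase B, cof (blockMatrix G W B'))
    (fun S hcut => ?_) (fun S₁ S₂ c h hS hnt₁ hnt₂ ih₁ ih₂ => ?_) hS
  · simp [blocksOf_eq_singleton hcut]
  · rw [h.det_blockMatrix_union hS, ih₁, ih₂,
      cof_blockMatrix_eq_prod (h.stronglyConnected_left hS),
      cof_blockMatrix_eq_prod (h.stronglyConnected_right hS), h.blocksOf_union hS hnt₁ hnt₂,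
      sum_mul_prod_erase_union (h.disjoint_blocksOf hS hnt₁)]

end Blocks

section Digraph

variable {V : Type*} [Fintype V] {G : Digraph V} {W : V → V → ℝ}

theorem blockMatrix_univ :
    blockMatrix G W Finset.univ = (distMatrix G W).submatrix
      (Equiv.subtypeUnivEquiv Finset.mem_univ) (Equiv.subtypeUnivEquiv Finset.mem_univ) := by
  rw [blockMatrix_eq_principal, distMatrix_eq_distIn_univ]
  rfl

theorem StronglyConnected.induced_univ (hG : StronglyConnected G) :
    StronglyConnected (induced G Finset.univ) := by
  have := hG.1
  refine stronglyConnected_induced_iff.2 ⟨Finset.univ_nonempty, fun x _ y _ => ?_⟩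
  simpa [IsPathIn] using hG.2 x y

variable [DecidableEq V]

theorem cof_distMatrix_eq_prod (hG : StronglyConnected G) :
    cof (distMatrix G W) = ∏ B ∈ blocks G, cof (blockMatrix G W B) := by
  rw [← blocksOf_univ, ← cof_blockMatrix_eq_prod hG.induced_univ, blockMatrix_univ,
    cof_submatrix_equiv]

theorem det_distMatrix_eq_sum (hG : StronglyConnected G) :
    (distMatrix G W).det = ∑ B ∈ blocks G,
      (blockMatrix G W B).det * ∏ B' ∈ (blocks G).erase B, cof (blockMatrix G W B') := by
  rw [← blocksOf_univ, ← det_blockMatrix_eq_sum hG.induced_univ, blockMatrix_univ,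
    det_submatrix_equiv_self]

end Digraph

end Cactoid

theorem mainTheorem4_general {V : Type*} [Fintype V] [DecidableEq V] (G : Digraph V)
    (hG : Cactoid.StronglyConnected G) (W : V → V → ℝ)
    (hcof : ∀ B ∈ Cactoid.blocks G, Cactoid.cof (Cactoid.blockMatrix G W B) ≠ 0) :
    (Cactoid.distMatrix G W).det =
        Cactoid.lam G W * ∏ B ∈ Cactoid.blocks G, Cactoid.cof (Cactoid.blockMatrix G W B) ∧
      Cactoid.lam G W * ∏ B ∈ Cactoid.blocks G, Cactoid.cof (Cactoid.blockMatrix G W B) =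
        Cactoid.lam G W * Cactoid.cof (Cactoid.distMatrix G W) := by
  rw [Cactoid.cof_distMatrix_eq_prod hG, Cactoid.det_distMatrix_eq_sum hG, Cactoid.lam,
    Finset.sum_mul]
  refine ⟨Finset.sum_congr rfl fun B hB => ?_, rfl⟩
  rw [← Finset.mul_prod_erase _ _ hB, ← mul_assoc, div_mul_cancel₀ _ (hcof B hB)]

theorem mainTheorem4 {V : Type*} [Fintype V] [DecidableEq V] (G : Digraph V)
    (hG : Cactoid.IsCactoidType G) (W : V → V → ℝ)
    (hcof : ∀ B ∈ Cactoid.blocks G, Cactoid.cof (Cactoid.blockMatrix G W B) ≠ 0) :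
    (Cactoid.distMatrix G W).det =
        Cactoid.lam G W * ∏ B ∈ Cactoid.blocks G, Cactoid.cof (Cactoid.blockMatrix G W B) ∧
      Cactoid.lam G W * ∏ B ∈ Cactoid.blocks G, Cactoid.cof (Cactoid.blockMatrix G W B) =
        Cactoid.lam G W * Cactoid.cof (Cactoid.distMatrix G W) :=
  mainTheorem4_general G hG.1 W hcof
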